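/- Let $H$ be a Lie group, not necessarily second countable, acting smoothly and locally freely (i.e. with discrete stabilizers) on the right on a second countable Hausdorff smooth manifold $M$. Let $H_0$ be the identity component of $H$, let $K:=H/H_0$ be the component group, and let $X:=M/H_0$ be the space of $H_0$-orbits with the quotient diffeology. The group $K$ acts on $X$ on the right by $[x]\cdot[h]=[x\cdot h]$; let $\rho:X\to X/K$ be the quotient map, where $X/K$ carries the quotient diffeology. Assume that one of the following two conditions holds: (a) $H$ is second countable; (b) the canonical map $$\Delta:X\times K\longrightarrow X\times_{X/K}X,\qquad (x,k)\longmapsto(x,x\cdot k),$$ is a subduction, i.e. a smooth surjection whose target carries the quotient diffeology induced by it, where $K$ carries the quotient diffeology of $H$ (which is the discrete diffeology), $X\times K$ has the product diffeology, and $X\times_{X/K}X=\{(x,y)\in X\times X:\rho(x)=\rho(y)\}$ has the subset diffeology inherited from $X\times X$. Then pullback by $\rho$ induces an isomorphism of cochain complexes $$\rho^*:\Omega^\bullet(X/K)\xrightarrow{\;\cong\;}\Omega^\bullet(X)^K$$ from the complex of diffeological differential forms on $X/K$ onto the complex of $K$-invariant diffeological differential forms on $X$, with the plotwise exterior derivatives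 as differentials. -/

import Mathlib

open scoped Manifold ContDiff Topology
open Diffeology CategoryTheory

noncomputable section

namespace DeRham

/-! ## Plots on open domains -/

/-- The Euclidean space `ℝⁿ`. -/
abbrev Euc (n : ℕ) : Type := EuclideanSpace ℝ (Fin n)

section Plots

variable {X Y Z : Type*} [DiffeologicalSpace X] [DiffeologicalSpace Y] [DiffeologicalSpace Z]

/-- The restriction of `p` to the (open) set `U ⊆ ℝⁿ` is a plot: each of its smooth
reparametrisations by some `ℝᵐ` is a plot. Only the values of `p` on `U` matter. -/
def IsPlotOn {n : ℕ} (U : Set (Euc n)) (p : Euc n → X) : Prop :=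
  ∀ (m : ℕ) (f : Euc m → Euc n), ContDiff ℝ ∞ f → (∀ x, f x ∈ U) → IsPlot (p ∘ f)

theorem isPlotOn_univ {n : ℕ} {p : Euc n → X} : IsPlotOn Set.univ p ↔ IsPlot p :=
  ⟨fun h => h n id contDiff_id (fun _ => trivial), fun h _ _ hf _ => isPlot_reparam h hf⟩

theorem isPlotOn_const {n : ℕ} (U : Set (Euc n)) (x : X) : IsPlotOn U (fun _ => x) :=
  fun _ _ _ _ => isPlot_const

theorem IsPlotOn.congr {n : ℕ} {U : Set (Euc n)} {p q : Euc n → X} (hp : IsPlotOn U p)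
    (h : Set.EqOn q p U) : IsPlotOn U q := by
  intro m f hf hU
  have : q ∘ f = p ∘ f := funext fun x => h (hU x)
  rw [this]
  exact hp m f hf hU

theorem IsPlotOn.reparam {m n : ℕ} {U : Set (Euc n)} {V : Set (Euc m)} {p : Euc n → X}
    {f : Euc m → Euc n} (hp : IsPlotOn U p) (hf : ContDiffOn ℝ ∞ f V) (h : Set.MapsTo f V U) :
    IsPlotOn V (p ∘ f) :=
  fun k g hg hV => hp k (f ∘ g) (hf.comp_contDiff hg hV) (fun x => h (hV x))

theorem IsPlotOn.mono {n : ℕ} {U V : Set (Euc n)} {p : Euc n → X} (hp : IsPlotOn U p)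
    (h : V ⊆ U) : IsPlotOn V p :=
  fun m f hf hV => hp m f hf fun x => h (hV x)

theorem IsPlotOn.of_local {n : ℕ} {U : Set (Euc n)} {p : Euc n → X}
    (h : ∀ x ∈ U, ∃ V : Set (Euc n), IsOpen V ∧ x ∈ V ∧ IsPlotOn V p) : IsPlotOn U p := by
  intro m f hf hU
  refine DiffeologicalSpace.locality fun y => ?_
  obtain ⟨V, hV, hy, hp⟩ := h (f y) (hU y)
  exact ⟨f ⁻¹' V, hV.preimage hf.continuous, hy, fun {k g} hg hgs =>
    hp k (f ∘ g) (hf.comp hgs) hg⟩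

theorem IsPlotOn.comp_dSmooth {n : ℕ} {U : Set (Euc n)} {p : Euc n → X} {φ : X → Y}
    (hp : IsPlotOn U p) (hφ : DSmooth φ) : IsPlotOn U (φ ∘ p) :=
  fun m f hf hU => hφ m _ (hp m f hf hU)

/-- Plots on open domains of a diffeology that was specified by its plots on open domains. -/
theorem isPlotOn_ofCorePlotsOn {X : Type*} (d : DiffeologicalSpace.CorePlotsOn X) {n : ℕ}
    {U : Set (Euc n)} (hU : IsOpen U) (p : Euc n → X) :
    @IsPlotOn X (DiffeologicalSpace.ofCorePlotsOn d) n U p ↔ d.isPlotOn hU p := by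
  let _ := DiffeologicalSpace.ofCorePlotsOn d
  constructor
  · intro h
    refine d.locality hU fun x hx => ?_
    obtain ⟨ε, hε, hball⟩ := Metric.isOpen_iff.mp hU x hx
    have h1 : d.isPlot (p ∘ OpenPartialHomeomorph.univBall x ε) :=
      h n (OpenPartialHomeomorph.univBall x ε) OpenPartialHomeomorph.contDiff_univBall
        (fun y => hball (by
          have := (OpenPartialHomeomorph.univBall x ε).map_source (x := y)
          rw [OpenPartialHomeomorph.univBall_target x hε] at this
          exact this (by simp)))
    have h2 := d.isPlotOn_reparam (Metric.isOpen_ball) (Set.mapsTo_univ _ _)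
      (d.isPlotOn_univ.mpr h1) (OpenPartialHomeomorph.contDiffOn_univBall_symm (c := x) (r := ε))
    refine ⟨_, Metric.isOpen_ball, Metric.mem_ball_self hε, (d.isPlotOn_congr _ ?_).mp h2⟩
    intro y hy
    have := (OpenPartialHomeomorph.univBall x ε).right_inv (x := y)
      (by rw [OpenPartialHomeomorph.univBall_target x hε]; exact hy)
    simp [Function.comp, this]
  · intro h m f hf hfU
    exact d.isPlotOn_univ.mp
      (d.isPlotOn_reparam isOpen_univ (fun x _ => hfU x) h hf.contDiffOn)

end Plots

/-! ## Manifold, subspace, product and quotient diffeologies, subductions -/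

/-- The diffeology of a smooth manifold: its plots are the smooth maps. -/
@[reducible] def manifoldDiffeology {E B : Type*} [NormedAddCommGroup E] [NormedSpace ℝ E]
    [TopologicalSpace B] (I : ModelWithCorners ℝ E B) (M : Type*) [TopologicalSpace M]
    [ChartedSpace B M] : DiffeologicalSpace M :=
  .ofCorePlotsOn {
    isPlotOn := fun {n U} _ p => ContMDiffOn 𝓘(ℝ, Euc n) I ∞ p U
    isPlotOn_congr := fun _ _ _ h => contMDiffOn_congr h
    isPlot_const := fun _ => contMDiffOn_const
    isPlotOn_reparam := fun _ _ _ h hp hf => hp.comp hf.contMDiffOn h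
    locality := fun _ _ h x hx => by
      obtain ⟨v, hv, hxv, hp⟩ := h x hx
      exact ((hp x hxv).contMDiffAt (hv.mem_nhds hxv)).contMDiffWithinAt }

/-- The subspace diffeology. -/
instance subspaceDiffeology {X : Type*} [DiffeologicalSpace X] (P : X → Prop) :
    DiffeologicalSpace (Subtype P) where
  plots _ := {p | IsPlot fun x => (p x : X)}
  constant_plots _ := isPlot_const
  plot_reparam hp hf := isPlot_reparam (X := X) hp hf
  locality hp := DiffeologicalSpace.locality (X := X) hp

/-- The product diffeology. -/
instance productDiffeology {X Y : Type*} [DiffeologicalSpace X] [DiffeologicalSpace Y] :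
    DiffeologicalSpace (X × Y) where
  plots _ := {p | IsPlot (fun x => (p x).1) ∧ IsPlot (fun x => (p x).2)}
  constant_plots _ := ⟨isPlot_const, isPlot_const⟩
  plot_reparam hp hf := ⟨isPlot_reparam (X := X) hp.1 hf, isPlot_reparam (X := Y) hp.2 hf⟩
  locality hp := by
    refine ⟨DiffeologicalSpace.locality (X := X) fun x => ?_,
      DiffeologicalSpace.locality (X := Y) fun x => ?_⟩
    · obtain ⟨u, hu, hx, h⟩ := hp x
      exact ⟨u, hu, hx, fun hf hs => (h hf hs).1⟩
    · obtain ⟨u, hu, hx, h⟩ := hp x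
      exact ⟨u, hu, hx, fun hf hs => (h hf hs).2⟩

/-- The quotient diffeology induced on `Y` by a surjection `π : X → Y`: its plots are the maps
that lift locally, through `π`, to plots of `X`. -/
@[reducible] def pushforwardDiffeology {X Y : Type*} [DiffeologicalSpace X] (π : X → Y)
    (hπ : Function.Surjective π) : DiffeologicalSpace Y :=
  .ofCorePlotsOn {
    isPlotOn := fun {n U} _ p => ∀ x ∈ U, ∃ V : Set (Euc n), IsOpen V ∧ x ∈ V ∧ V ⊆ U ∧
      ∃ g : Euc n → X, IsPlotOn V g ∧ Set.EqOn p (π ∘ g) V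
    isPlotOn_congr := fun {n U} _ {p q} h => by
      refine forall₂_congr fun x _ => exists_congr fun V => and_congr_right fun _ =>
        and_congr_right fun _ => and_congr_right fun hVU => exists_congr fun g =>
        and_congr_right fun _ => ?_
      exact ⟨fun h1 y hy => (h (hVU hy)).symm.trans (h1 hy),
        fun h1 y hy => (h (hVU hy)).trans (h1 hy)⟩
    isPlot_const := fun {n} y x _ => by
      obtain ⟨a, rfl⟩ := hπ y
      exact ⟨Set.univ, isOpen_univ, trivial, subset_rfl, fun _ => a, isPlotOn_const _ _,
        fun _ _ => rfl⟩
    isPlotOn_reparam := fun {n m U V _} hV {p f} h hp hf x hx => by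
      obtain ⟨W, hW, hxW, -, g, hg, hpg⟩ := hp (f x) (h hx)
      exact ⟨V ∩ f ⁻¹' W, hf.continuousOn.isOpen_inter_preimage hV hW, ⟨hx, hxW⟩,
        Set.inter_subset_left, g ∘ f,
        hg.reparam (hf.mono Set.inter_subset_left) (fun _ hy => hy.2), fun _ hy => hpg hy.2⟩
    locality := fun {n U} hU {p} h x hx => by
      obtain ⟨v, hv, hxv, hp⟩ := h x hx
      obtain ⟨W, hW, hxW, -, g, hg, hpg⟩ := hp x hxv
      exact ⟨W ∩ U, hW.inter hU, ⟨hxW, hx⟩, Set.inter_subset_right, g,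
        hg.mono Set.inter_subset_left, fun _ hy => hpg hy.1⟩ }

/-- The quotient diffeology on the quotient by an equivalence relation. -/
instance quotientDiffeology {X : Type*} [DiffeologicalSpace X] (s : Setoid X) :
    DiffeologicalSpace (Quotient s) :=
  pushforwardDiffeology (Quotient.mk s) Quotient.mk_surjective

/-- The quotient diffeology on a coset space `G ⧸ N`. -/
instance cosetDiffeology {G : Type*} [Group G] [DiffeologicalSpace G] (N : Subgroup G) :
    DiffeologicalSpace (G ⧸ N) :=
  quotientDiffeology (QuotientGroup.leftRel N)

/-- A subduction: a smooth surjection whose target carries the quotient diffeology induced by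
the map. -/
structure IsSubduction {X Y : Type*} [DiffeologicalSpace X] [dY : DiffeologicalSpace Y]
    (π : X → Y) : Prop where
  dSmooth : DSmooth π
  surjective : Function.Surjective π
  eq_pushforward : dY = pushforwardDiffeology π surjective

theorem isPlotOn_pushforward_iff {X Y : Type*} [DiffeologicalSpace X] (π : X → Y)
    (hπ : Function.Surjective π) {n : ℕ} {U : Set (Euc n)} (hU : IsOpen U) (p : Euc n → Y) :
    @IsPlotOn Y (pushforwardDiffeology π hπ) n U p ↔
      ∀ x ∈ U, ∃ V : Set (Euc n), IsOpen V ∧ x ∈ V ∧ V ⊆ U ∧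
        ∃ g : Euc n → X, IsPlotOn V g ∧ Set.EqOn p (π ∘ g) V :=
  isPlotOn_ofCorePlotsOn _ hU p

theorem dSmooth_pushforward {X Y : Type*} [DiffeologicalSpace X] (π : X → Y)
    (hπ : Function.Surjective π) :
    @DSmooth X Y _ (pushforwardDiffeology π hπ) π := by
  let _ := pushforwardDiffeology π hπ
  intro n p hp
  rw [← isPlotOn_univ, isPlotOn_pushforward_iff π hπ isOpen_univ]
  exact fun x _ => ⟨Set.univ, isOpen_univ, trivial, subset_rfl, p, isPlotOn_univ.2 hp,
    fun _ _ => rfl⟩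

theorem dSmooth_quotientMk {X : Type*} [DiffeologicalSpace X] (s : Setoid X) :
    DSmooth (Quotient.mk s) :=
  dSmooth_pushforward (Quotient.mk s) Quotient.mk_surjective

/-! ## Differential forms -/

section Forms

variable {X Y : Type*} [DiffeologicalSpace X] [DiffeologicalSpace Y]

/-- A plot `p : U → X` with open domain `U ⊆ ℝⁿ`; the values of the map off `U` are irrelevant. -/
structure Plot (X : Type*) [DiffeologicalSpace X] where
  /-- the dimension `n` -/
  dim : ℕ
  /-- the domain `U` -/
  dom : TopologicalSpace.Opens (Euc dim)
  /-- the map `p` -/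
  map : Euc dim → X
  isPlotOn : IsPlotOn (dom : Set (Euc dim)) map

/-- The composite of a plot with a smooth map. -/
def Plot.comp (φ : X → Y) (hφ : DSmooth φ) (p : Plot X) : Plot Y :=
  ⟨p.dim, p.dom, φ ∘ p.map, p.isPlotOn.comp_dSmooth hφ⟩

/-- The differential `k`-forms on a diffeological space, as a subspace: to each plot `p : U → X` is assigned a smooth `k`-form on `U`, compatibly with smooth maps `f : V → U`
between open sets. A form on `U` is represented by a function on `ℝⁿ` that is zero off `U`. -/
def formSubmodule (X : Type*) [DiffeologicalSpace X] (k : ℕ) :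
    Submodule ℝ (∀ p : Plot X, Euc p.dim → Euc p.dim [⋀^Fin k]→L[ℝ] ℝ) where
  carrier := {γ |
    (∀ p : Plot X, ContDiffOn ℝ ∞ (γ p) p.dom) ∧
    (∀ p : Plot X, ∀ x ∉ p.dom, γ p x = 0) ∧
    (∀ (p q : Plot X) (f : Euc q.dim → Euc p.dim),
      ContDiffOn ℝ ∞ f q.dom → Set.MapsTo f q.dom p.dom →
      Set.EqOn q.map (p.map ∘ f) q.dom →
      ∀ x ∈ q.dom, γ q x = (γ p (f x)).compContinuousLinearMap (fderiv ℝ f x))}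
  add_mem' := by
    rintro a b ⟨ha1, ha2, ha3⟩ ⟨hb1, hb2, hb3⟩
    refine ⟨fun p => (ha1 p).add (hb1 p), fun p x hx => ?_, fun p q f hf hm he x hx => ?_⟩
    · simp [ha2 p x hx, hb2 p x hx]
    · simp only [Pi.add_apply, ha3 p q f hf hm he x hx, hb3 p q f hf hm he x hx]
      rfl
  zero_mem' := ⟨fun _ => contDiffOn_const, fun _ _ _ => rfl, fun _ _ _ _ _ _ _ _ => rfl⟩
  smul_mem' := by
    rintro c a ⟨ha1, ha2, ha3⟩
    refine ⟨fun p => (ha1 p).const_smul c, fun p x hx => ?_, fun p q f hf hm he x hx => ?_⟩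
    · simp [ha2 p x hx]
    · simp only [Pi.smul_apply, ha3 p q f hf hm he x hx]
      rfl

/-- The vector space `Ωᵏ(X)` of differential `k`-forms on a diffeological space. -/
def Form (X : Type*) [DiffeologicalSpace X] (k : ℕ) : Type _ := formSubmodule X k

instance (k : ℕ) : AddCommGroup (Form X k) := inferInstanceAs (AddCommGroup (formSubmodule X k))

instance (k : ℕ) : Module ℝ (Form X k) := inferInstanceAs (Module ℝ (formSubmodule X k))

theorem Form.add_val {k : ℕ} (a b : Form X k) : (a + b).1 = a.1 + b.1 := rfl

theorem Form.smul_val {k : ℕ} (c : ℝ) (a : Form X k) : (c • a).1 = c • a.1 := rfl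

/-- Pullback of forms along a smooth map: `(φ^* γ)_p = γ_{φ ∘ p}`. -/
def pullback (φ : X → Y) (hφ : DSmooth φ) (k : ℕ) : Form Y k →ₗ[ℝ] Form X k where
  toFun γ := ⟨fun p => γ.1 (p.comp φ hφ), fun p => γ.2.1 (p.comp φ hφ),
    fun p => γ.2.2.1 (p.comp φ hφ),
    fun p q f hf hm he x hx => γ.2.2.2 (p.comp φ hφ) (q.comp φ hφ) f hf hm
      (fun _ hy => congrArg φ (he hy)) x hx⟩
  map_add' _ _ := rfl
  map_smul' _ _ := rfl

open Classical in
/-- The exterior derivative of a form, plot by plot. -/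
def extDFun {k : ℕ} (γ : Form X k) : Form X (k + 1) :=
  ⟨fun p x => if x ∈ p.dom then extDeriv (γ.1 p) x else 0, by
    refine ⟨fun p => ?_, fun p x hx => if_neg hx, fun p q f hf hm he x hx => ?_⟩
    · have h1 : ContDiffOn ℝ ∞ (fderiv ℝ (γ.1 p)) p.dom :=
        (γ.2.1 p).fderiv_of_isOpen p.dom.isOpen (by simp)
      have hA := ContinuousLinearMap.contDiff (𝕜 := ℝ) (n := ∞)
        (E := Euc p.dim →L[ℝ] Euc p.dim [⋀^Fin k]→L[ℝ] ℝ)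
        (F := Euc p.dim [⋀^Fin (k + 1)]→L[ℝ] ℝ)
        (ContinuousAlternatingMap.alternatizeUncurryFinCLM ℝ (Euc p.dim) ℝ)
      have h2 : ContDiffOn ℝ ∞ (extDeriv (γ.1 p)) p.dom := hA.comp_contDiffOn h1
      exact h2.congr fun x hx => if_pos hx
    · have hU : (p.dom : Set (Euc p.dim)) ∈ 𝓝 (f x) := p.dom.isOpen.mem_nhds (hm hx)
      have hV : (q.dom : Set (Euc q.dim)) ∈ 𝓝 x := q.dom.isOpen.mem_nhds hx
      simp only [if_pos hx, if_pos (show f x ∈ p.dom from hm hx)]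
      have hev : γ.1 q =ᶠ[𝓝 x] fun y =>
          (γ.1 p (f y)).compContinuousLinearMap (fderiv ℝ f y) :=
        Filter.eventually_of_mem hV fun y hy => γ.2.2.2 p q f hf hm he y hy
      rw [hev.extDeriv_eq]
      refine extDeriv_pullback (r := ∞)
        (((γ.2.1 p).contDiffAt hU).differentiableAt (by simp)) (hf.contDiffAt hV) ?_
      rw [minSmoothness_of_isRCLikeNormedField]
      exact WithTop.coe_le_coe.2 le_top⟩

theorem extDFun_apply {k : ℕ} (γ : Form X k) (p : Plot X) {x : Euc p.dim} (hx : x ∈ p.dom) :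
    (extDFun γ).1 p x = extDeriv (γ.1 p) x :=
  if_pos hx

theorem extDFun_off {k : ℕ} (γ : Form X k) (p : Plot X) {x : Euc p.dim} (hx : x ∉ p.dom) :
    (extDFun γ).1 p x = 0 :=
  if_neg hx

/-- The exterior derivative `d : Ωᵏ(X) → Ωᵏ⁺¹(X)`. -/
def extD (X : Type*) [DiffeologicalSpace X] (k : ℕ) : Form X k →ₗ[ℝ] Form X (k + 1) where
  toFun := extDFun
  map_add' a b := by
    refine Subtype.ext ?_
    funext p x
    rw [Form.add_val, Pi.add_apply, Pi.add_apply]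
    by_cases hx : x ∈ p.dom
    · have hU : (p.dom : Set (Euc p.dim)) ∈ 𝓝 x := p.dom.isOpen.mem_nhds hx
      rw [extDFun_apply _ p hx, extDFun_apply _ p hx, extDFun_apply _ p hx]
      exact extDeriv_add (((a.2.1 p).contDiffAt hU).differentiableAt (by simp))
        (((b.2.1 p).contDiffAt hU).differentiableAt (by simp))
    · rw [extDFun_off _ p hx, extDFun_off _ p hx, extDFun_off _ p hx, add_zero]
  map_smul' c a := by
    refine Subtype.ext ?_
    funext p x
    rw [RingHom.id_apply, Form.smul_val, Pi.smul_apply, Pi.smul_apply]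
    by_cases hx : x ∈ p.dom
    · rw [extDFun_apply _ p hx, extDFun_apply _ p hx]
      exact extDeriv_smul c _
    · rw [extDFun_off _ p hx, extDFun_off _ p hx, smul_zero]

theorem extD_apply {k : ℕ} (γ : Form X k) (p : Plot X) {x : Euc p.dim} (hx : x ∈ p.dom) :
    (extD X k γ).1 p x = extDeriv (γ.1 p) x :=
  extDFun_apply γ p hx

theorem extD_extD {k : ℕ} (γ : Form X k) : extD X (k + 1) (extD X k γ) = 0 := by
  refine Subtype.ext ?_
  funext p x
  by_cases hx : x ∈ p.dom
  · have hU : (p.dom : Set (Euc p.dim)) ∈ 𝓝 x := p.dom.isOpen.mem_nhds hx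
    rw [extD_apply _ p hx]
    have hev : (extD X k γ).1 p =ᶠ[𝓝 x] extDeriv (γ.1 p) :=
      Filter.eventually_of_mem hU fun y hy => extD_apply γ p hy
    rw [hev.extDeriv_eq]
    refine extDeriv_extDeriv_apply (r := ∞) ((γ.2.1 p).contDiffAt hU) ?_
    rw [minSmoothness_of_isRCLikeNormedField]
    exact WithTop.coe_le_coe.2 le_top
  · exact if_neg hx

theorem extD_pullback (φ : X → Y) (hφ : DSmooth φ) {k : ℕ} (γ : Form Y k) :
    extD X k (pullback φ hφ k γ) = pullback φ hφ (k + 1) (extD Y k γ) :=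
  rfl

/-- The de Rham complex `Ω^•(X)` of a diffeological space. -/
def deRhamComplex (X : Type*) [DiffeologicalSpace X] : CochainComplex (ModuleCat ℝ) ℕ :=
  CochainComplex.of (fun k => ModuleCat.of ℝ (Form X k)) (fun k => ModuleCat.ofHom (extD X k))
    (fun k => by
      rw [← ModuleCat.ofHom_comp]
      exact congrArg ModuleCat.ofHom (LinearMap.ext fun γ => extD_extD γ))

end Forms

/-! ## Invariant forms -/

section Invariant

/-- A group (or monoid) acts on a diffeological space: each `g` acts by a smooth map. For a group
these maps are then diffeological diffeomorphisms. -/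
class SmoothConstSMul (G X : Type*) [DiffeologicalSpace X] [SMul G X] : Prop where
  dSmooth_smul : ∀ g : G, DSmooth (fun x : X => g • x)

/-- The quotient map `X → X/G` onto the orbit space. -/
def orbitMk (G X : Type*) [Group G] [MulAction G X] (x : X) : MulAction.orbitRel.Quotient G X :=
  Quotient.mk (MulAction.orbitRel G X) x

theorem orbitMk_smul (G X : Type*) [Group G] [MulAction G X] (g : G) (x : X) :
    orbitMk G X (g • x) = orbitMk G X x :=
  MulAction.orbitRel.Quotient.quotient_smul_eq

variable (G X : Type*) [Group G] [DiffeologicalSpace X] [MulAction G X]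

/-- The space `Ωᵏ(X)^G` of invariant `k`-forms. -/
def invariantForm [SmoothConstSMul G X] (k : ℕ) : Submodule ℝ (Form X k) where
  carrier := {α | ∀ g : G,
    pullback (fun x : X => g • x) (SmoothConstSMul.dSmooth_smul g) k α = α}
  add_mem' ha hb g := by rw [map_add, ha g, hb g]
  zero_mem' g := map_zero _
  smul_mem' c a ha g := by rw [map_smul, ha g]

/-- The exterior derivative of invariant forms. -/
def extDInvariant [SmoothConstSMul G X] (k : ℕ) :
    invariantForm G X k →ₗ[ℝ] invariantForm G X (k + 1) :=
  (extD X k).restrict fun α hα g => by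
    rw [← extD_pullback, hα g]

/-- The complex `Ω^•(X)^G` of invariant forms. -/
def invariantComplex [SmoothConstSMul G X] : CochainComplex (ModuleCat ℝ) ℕ :=
  CochainComplex.of (fun k => ModuleCat.of ℝ (invariantForm G X k))
    (fun k => ModuleCat.ofHom (extDInvariant G X k))
    (fun k => by
      rw [← ModuleCat.ofHom_comp]
      exact congrArg ModuleCat.ofHom
        (LinearMap.ext fun γ => Subtype.ext (extD_extD (γ : Form X k))))

theorem dSmooth_orbitMk : DSmooth (orbitMk G X) := dSmooth_quotientMk _

/-- Pullback of `k`-forms along `X → X/G`, as a map into the invariant forms. -/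
def pullbackInvariant [SmoothConstSMul G X] (k : ℕ) :
    Form (MulAction.orbitRel.Quotient G X) k →ₗ[ℝ] invariantForm G X k :=
  (pullback (orbitMk G X) (dSmooth_orbitMk G X) k).codRestrict _ fun γ g => by
    refine Subtype.ext ?_
    funext p
    have h : (p.comp (fun x : X => g • x) (SmoothConstSMul.dSmooth_smul g)).comp (orbitMk G X)
        (dSmooth_orbitMk G X) = p.comp (orbitMk G X) (dSmooth_orbitMk G X) := by
      have : orbitMk G X ∘ (fun x : X => g • x) ∘ p.map = orbitMk G X ∘ p.map :=
        funext fun x => orbitMk_smul G X g (p.map x)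
      simp only [Plot.comp, this]
    change γ.1 ((p.comp (fun x : X => g • x) (SmoothConstSMul.dSmooth_smul g)).comp
      (orbitMk G X) (dSmooth_orbitMk G X)) = γ.1 (p.comp (orbitMk G X) (dSmooth_orbitMk G X))
    exact eq_of_heq (congr_arg_heq γ.1 h)

/-- Pullback along `ρ : X → X/G`, as a map of cochain complexes `Ω^•(X/G) → Ω^•(X)^G`. -/
def pullbackComplex [SmoothConstSMul G X] :
    deRhamComplex (MulAction.orbitRel.Quotient G X) ⟶ invariantComplex G X :=
  CochainComplex.ofHom (X := deRhamComplex (MulAction.orbitRel.Quotient G X))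
    (Y := invariantComplex G X) (fun k => ModuleCat.ofHom (pullbackInvariant G X k)) (fun k => by
      simp only [deRhamComplex, invariantComplex, CochainComplex.of_d]
      rfl)

end Invariant

/-! ## The two-step quotient of a right action -/

section TwoStep

open MulOpposite

/-- The canonical map `X × K → X ×_{X/K} X`, `(x, k) ↦ (x, x · k)`, for a right action
of `K` on `X`; a right action is an action of the opposite group. -/
def canonicalMap (X K : Type*) [Group K] [MulAction Kᵐᵒᵖ X] (a : X × K) :
    {z : X × X // orbitMk Kᵐᵒᵖ X z.1 = orbitMk Kᵐᵒᵖ X z.2} :=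
  ⟨(a.1, op a.2 • a.1), (orbitMk_smul Kᵐᵒᵖ X (op a.2) a.1).symm⟩

variable {G : Type*} [Group G] (N : Subgroup G) (M : Type*) [MulAction Gᵐᵒᵖ M]

/-- The orbit space `M/N` for the restriction of a right action of `G` to a subgroup `N`. -/
abbrev OrbitSpace : Type _ := MulAction.orbitRel.Quotient N.op M

/-- The right action of `G ⧸ N` on `M/N` given by `[x] · [g] = [x · g]`. -/
instance cosetSMul [N.Normal] : SMul (G ⧸ N)ᵐᵒᵖ (OrbitSpace N M) where
  smul k := Quotient.map₂ (sa := QuotientGroup.leftRel N) (fun g x => op g • x) (by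
    intro g g' hg x x' hx
    obtain ⟨⟨n, hn⟩, rfl⟩ := hx
    have hg2 : g⁻¹ * g' ∈ N := QuotientGroup.leftRel_apply.1 hg
    have hn2 : n.unop ∈ N := hn
    have h : (g⁻¹ * g')⁻¹ * (g⁻¹ * n.unop * g) ∈ N := by
      refine N.mul_mem (N.inv_mem hg2) ?_
      have := ‹N.Normal›.conj_mem n.unop hn2 g⁻¹
      simpa using this
    refine ⟨⟨op ((g⁻¹ * g')⁻¹ * (g⁻¹ * n.unop * g)), h⟩, ?_⟩
    change op ((g⁻¹ * g')⁻¹ * (g⁻¹ * n.unop * g)) • op g' • x' = op g • n • x'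
    rw [smul_smul, smul_smul]
    congr 1
    apply unop_injective
    simp [mul_assoc]) k.unop

theorem coset_smul_mk [N.Normal] (g : G) (x : M) :
    op (QuotientGroup.mk g : G ⧸ N) • (orbitMk N.op M x) = orbitMk N.op M (op g • x) :=
  rfl

instance cosetMulAction [N.Normal] : MulAction (G ⧸ N)ᵐᵒᵖ (OrbitSpace N M) where
  one_smul y := by
    induction y using Quotient.inductionOn with
    | _ x => exact congrArg (orbitMk N.op M) (one_smul Gᵐᵒᵖ x)
  mul_smul a b y := by
    obtain ⟨a, rfl⟩ := op_surjective a
    obtain ⟨b, rfl⟩ := op_surjective b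
    induction y using Quotient.inductionOn with
    | _ x =>
      induction a using QuotientGroup.induction_on with
      | _ a =>
        induction b using QuotientGroup.induction_on with
        | _ b => exact congrArg (orbitMk N.op M) (mul_smul (op a) (op b) x)

instance [N.Normal] [DiffeologicalSpace M] [SmoothConstSMul Gᵐᵒᵖ M] :
    SmoothConstSMul (G ⧸ N)ᵐᵒᵖ (OrbitSpace N M) where
  dSmooth_smul k := by
    obtain ⟨k, rfl⟩ := op_surjective k
    induction k using QuotientGroup.induction_on with
    | _ g =>
      intro n p hp
      rw [← isPlotOn_univ] at hp ⊢
      have hp2 := (isPlotOn_pushforward_iff (orbitMk N.op M) Quotient.mk_surjective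
        isOpen_univ p).1 hp
      refine (isPlotOn_pushforward_iff (orbitMk N.op M) Quotient.mk_surjective
        isOpen_univ _).2 fun x hx => ?_
      obtain ⟨V, hV, hxV, hVU, q, hq, he⟩ := hp2 x hx
      refine ⟨V, hV, hxV, hVU, (fun y : M => op g • y) ∘ q,
        hq.comp_dSmooth (SmoothConstSMul.dSmooth_smul (op g)), fun y hy => ?_⟩
      change op (QuotientGroup.mk g : G ⧸ N) • p y = _
      rw [he hy]
      rfl

end TwoStep

/-! ## Smooth right actions of Lie groups -/

section Lie

open MulOpposite

/-- The identity component of a topological group. -/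
abbrev idComponent (H : Type*) [TopologicalSpace H] [Group H] [IsTopologicalGroup H] :
    Subgroup H :=
  Subgroup.connectedComponentOfOne H

instance idComponent_normal (H : Type*) [TopologicalSpace H] [Group H] [IsTopologicalGroup H] :
    (idComponent H).Normal where
  conj_mem n hn g := by
    have hc : Continuous fun x : H => g * x * g⁻¹ := by fun_prop
    have h := hc.image_connectedComponent_subset 1
    have h1 : g * n * g⁻¹ ∈ connectedComponent (g * 1 * g⁻¹) := h ⟨n, hn, rfl⟩
    rw [mul_one, mul_inv_cancel] at h1
    exact h1

/-- A smooth right action on a manifold is an action on the underlying diffeological space. -/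
theorem smoothConstSMul_of_contMDiff {E F M H : Type*} [NormedAddCommGroup E] [NormedSpace ℝ E]
    [NormedAddCommGroup F] [NormedSpace ℝ F] [TopologicalSpace M] [ChartedSpace E M]
    [TopologicalSpace H] [ChartedSpace F H] [Group H] [MulAction Hᵐᵒᵖ M]
    (hact : ContMDiff (𝓘(ℝ, E).prod 𝓘(ℝ, F)) 𝓘(ℝ, E) ∞ (fun a : M × H => op a.2 • a.1)) :
    letI : DiffeologicalSpace M := manifoldDiffeology 𝓘(ℝ, E) M
    SmoothConstSMul Hᵐᵒᵖ M := by
  let _ : DiffeologicalSpace M := manifoldDiffeology 𝓘(ℝ, E) M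
  refine ⟨fun g n p hp => ?_⟩
  have h1 : ContMDiff 𝓘(ℝ, E) 𝓘(ℝ, E) ∞ (fun x : M => g • x) :=
    hact.comp (contMDiff_id.prodMk (contMDiff_const (c := g.unop)))
  have hp2 : ContMDiffOn 𝓘(ℝ, Euc n) 𝓘(ℝ, E) ∞ p Set.univ := hp
  exact h1.comp_contMDiffOn hp2

end Lie

end DeRham

end

/-! Every plot of `X/K` lifts locally to `X`, so a form on `X/K` is determined by its pullback, and
`ρ^*` is injective with no further assumption. For surjectivity, an invariant form should be
evaluated on a plot of `X/K` through any local lift; this is well defined once two lifts `p`, `q` of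
one plot always give the same form. If `q = p · k` with `k` constant, this is invariance. Since
forms are continuous, it is enough that such a `k` exists near each point of a dense set: this is
`PlotsDenselyTranslate`, and `isIso_pullbackComplex` draws the conclusion from it.

Under (b), `(p, q)` lifts locally through the canonical map, and its `K`-component is locally
constant because `K` is discrete; here `k` exists near every point. Under (a), `p` and `q` are
lifted further to `M`, where their values differ by elements of `H`. Countably many closed sets,
indexed by components of `H` and compact pieces, record which elements occur, and Baire's theorem
makes the union of their interiors dense. -/

namespace DeRham

/-! ### Descent of invariant forms to the orbit space -/

section Descent

/-- Both plots restrict to the same plot on `W`, and compatibility along the inclusion, whose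
derivative is the identity, does the rest. Values of forms thus depend only on germs of plots. -/
theorem Form.val_eq_of_eqOn {X : Type*} [DiffeologicalSpace X] {k n : ℕ} (α : Form X k)
    {U V W : TopologicalSpace.Opens (Euc n)} {p q : Euc n → X} (hp : IsPlotOn (U : Set (Euc n)) p)
    (hq : IsPlotOn (V : Set (Euc n)) q) (hWU : W ≤ U) (hWV : W ≤ V)
    (h : Set.EqOn q p W) {x : Euc n} (hx : x ∈ W) :
    α.1 ⟨n, V, q, hq⟩ x = α.1 ⟨n, U, p, hp⟩ x := by
  have h1 := α.2.2.2 ⟨n, U, p, hp⟩ ⟨n, W, p, hp.mono hWU⟩ id contDiffOn_id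
    (fun _ hy => hWU hy) (fun _ _ => rfl) x hx
  have h2 := α.2.2.2 ⟨n, V, q, hq⟩ ⟨n, W, p, hp.mono hWU⟩ id contDiffOn_id
    (fun _ hy => hWV hy) (fun _ hy => (h hy).symm) x hx
  rw [h1] at h2
  simp only [fderiv_id, id_eq] at h2
  exact h2.symm

variable (G X : Type*) [Group G] [DiffeologicalSpace X] [MulAction G X]

/-- Any two plots of `X` on a common open domain with the same projection to `X/G` are, locally
around the points of a dense set, translates of each other by a constant element of `G`. -/
def PlotsDenselyTranslate : Prop :=
  ∀ (n : ℕ) (U : Set (Euc n)), IsOpen U → ∀ p q : Euc n → X, IsPlotOn U p → IsPlotOn U q →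
    Set.EqOn (orbitMk G X ∘ p) (orbitMk G X ∘ q) U →
    U ⊆ closure {x | x ∈ U ∧ ∃ g : G, ∃ V : Set (Euc n), IsOpen V ∧ x ∈ V ∧ V ⊆ U ∧
      ∀ y ∈ V, q y = g • p y}

variable {G X}

theorem invariantForm_val_eq [SmoothConstSMul G X] (H : PlotsDenselyTranslate G X) {k n : ℕ}
    (α : invariantForm G X k) {U : TopologicalSpace.Opens (Euc n)} {p q : Euc n → X}
    (hp : IsPlotOn (U : Set (Euc n)) p) (hq : IsPlotOn (U : Set (Euc n)) q)
    (h : Set.EqOn (orbitMk G X ∘ p) (orbitMk G X ∘ q) U) :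
    Set.EqOn (α.1.1 ⟨n, U, p, hp⟩) (α.1.1 ⟨n, U, q, hq⟩) U := by
  -- Both sides are continuous on `U`, so only points near which `q` is a constant translate of `p`
  -- need checking; there invariance applies.
  refine Set.EqOn.of_subset_closure ?_ (α.1.2.1 ⟨n, U, p, hp⟩).continuousOn
    (α.1.2.1 ⟨n, U, q, hq⟩).continuousOn (fun x hx => hx.1) (H n U U.isOpen p q hp hq h)
  rintro x ⟨-, g, V, hV, hxV, hVU, hg⟩
  have hinv := α.2 g
  have h1 : α.1.1 (Plot.comp (fun x : X => g • x) (SmoothConstSMul.dSmooth_smul g)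
      ⟨n, U, p, hp⟩) = α.1.1 ⟨n, U, p, hp⟩ :=
    congrFun (congrArg Subtype.val hinv) ⟨n, U, p, hp⟩
  rw [← h1]
  exact (α.1.val_eq_of_eqOn (W := ⟨V, hV⟩)
    (hp.comp_dSmooth (SmoothConstSMul.dSmooth_smul g)) hq hVU hVU hg hxV).symm

/-- The local lifts, near `x`, of a plot of `X/G` to plots of `X`. -/
structure LocalLift (p : Plot (MulAction.orbitRel.Quotient G X)) (x : Euc p.dim) where
  dom : TopologicalSpace.Opens (Euc p.dim)
  mem : x ∈ dom
  le : dom ≤ p.dom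
  map : Euc p.dim → X
  isPlotOn : IsPlotOn (dom : Set (Euc p.dim)) map
  eqOn : Set.EqOn p.map (orbitMk G X ∘ map) dom

/-- A local lift, regarded as a plot. -/
def LocalLift.plot {p : Plot (MulAction.orbitRel.Quotient G X)} {x : Euc p.dim}
    (l : LocalLift p x) : Plot X :=
  ⟨p.dim, l.dom, l.map, l.isPlotOn⟩

theorem nonempty_localLift (p : Plot (MulAction.orbitRel.Quotient G X)) {x : Euc p.dim}
    (hx : x ∈ p.dom) : Nonempty (LocalLift p x) := by
  obtain ⟨V, hV, hxV, hVU, g, hg, he⟩ := (isPlotOn_pushforward_iff (orbitMk G X)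
    Quotient.mk_surjective p.dom.isOpen p.map).1 p.isPlotOn x hx
  exact ⟨⟨⟨V, hV⟩, hxV, hVU, g, hg, he⟩⟩

/-- Where both are defined, `m.map` and `l.map ∘ f` lift the same plot of `X/G`, so the invariant
form cannot tell them apart. With `f = id` this gives independence of the lift; for general `f` it
gives compatibility of the descended form. -/
theorem LocalLift.val_eq [SmoothConstSMul G X] (H : PlotsDenselyTranslate G X) {k : ℕ}
    (α : invariantForm G X k) {p q : Plot (MulAction.orbitRel.Quotient G X)}
    {f : Euc q.dim → Euc p.dim} (hf : ContDiffOn ℝ ∞ f q.dom)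
    (he : Set.EqOn q.map (p.map ∘ f) q.dom) {x y : Euc q.dim} {z : Euc p.dim}
    (l : LocalLift p z) (m : LocalLift q y) (hx : x ∈ m.dom) (hfx : f x ∈ l.dom) :
    α.1.1 m.plot x = (α.1.1 l.plot (f x)).compContinuousLinearMap (fderiv ℝ f x) := by
  have hf' : ContDiffOn ℝ ∞ f m.dom := hf.mono m.le
  let W : TopologicalSpace.Opens (Euc q.dim) :=
    ⟨(m.dom : Set (Euc q.dim)) ∩ f ⁻¹' l.dom,
      hf'.continuousOn.isOpen_inter_preimage m.dom.isOpen l.dom.isOpen⟩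
  have hW : W ≤ m.dom := fun _ hw => hw.1
  have hxW : x ∈ W := ⟨hx, hfx⟩
  have hfW : ContDiffOn ℝ ∞ f W := hf'.mono hW
  have hlW : IsPlotOn (W : Set (Euc q.dim)) (l.map ∘ f) :=
    l.isPlotOn.reparam hfW fun _ hw => hw.2
  have h1 := α.1.2.2.2 l.plot ⟨q.dim, W, l.map ∘ f, hlW⟩ f hfW (fun _ hw => hw.2)
    (fun _ _ => rfl) x hxW
  rw [← h1]
  refine (α.1.val_eq_of_eqOn (m.isPlotOn.mono hW) m.isPlotOn le_rfl hW (fun _ _ => rfl) hxW).trans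
    (invariantForm_val_eq H α (m.isPlotOn.mono hW) hlW (fun w hw => ?_) hxW)
  exact ((m.eqOn hw.1).symm.trans (he (m.le hw.1))).trans (l.eqOn hw.2)

open Classical in
/-- The form on `X/G` to which an invariant form descends, plot by plot. -/
noncomputable def descendVal [SmoothConstSMul G X] {k : ℕ} (α : invariantForm G X k)
    (p : Plot (MulAction.orbitRel.Quotient G X)) (x : Euc p.dim) :
    Euc p.dim [⋀^Fin k]→L[ℝ] ℝ :=
  if hx : x ∈ p.dom then α.1.1 (nonempty_localLift p hx).some.plot x else 0

/-- The lift chosen in `descendVal` varies with the point. One fixed lift computes the value on its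
whole domain, which is what makes the descended form smooth. -/
theorem descendVal_eq [SmoothConstSMul G X] (H : PlotsDenselyTranslate G X) {k : ℕ}
    (α : invariantForm G X k) {p : Plot (MulAction.orbitRel.Quotient G X)} {x z : Euc p.dim}
    (l : LocalLift p z) (hx : x ∈ l.dom) : descendVal α p x = α.1.1 l.plot x := by
  have hp : x ∈ p.dom := l.le hx
  refine (dif_pos hp).trans ?_
  have := LocalLift.val_eq H α (f := id) contDiffOn_id (fun _ _ => rfl) l
    (nonempty_localLift p hp).some (nonempty_localLift p hp).some.mem hx
  exact this.trans (congrArg (α.1.1 l.plot x).compContinuousLinearMap fderiv_id)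

/-- The form on `X/G` to which an invariant form descends. -/
noncomputable def descend [SmoothConstSMul G X] (H : PlotsDenselyTranslate G X) {k : ℕ}
    (α : invariantForm G X k) : Form (MulAction.orbitRel.Quotient G X) k :=
  ⟨descendVal α, by
    refine ⟨fun p x hx => ?_, fun p x hx => dif_neg hx, fun p q f hf hm he x hx => ?_⟩
    · obtain ⟨l⟩ := nonempty_localLift p hx
      have h1 : ContDiffAt ℝ ∞ (α.1.1 l.plot) x :=
        (α.1.2.1 l.plot).contDiffAt (l.dom.isOpen.mem_nhds l.mem)
      exact (h1.congr_of_eventuallyEq (Filter.eventually_of_mem (l.dom.isOpen.mem_nhds l.mem)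
        fun y hy => descendVal_eq H α l hy)).contDiffWithinAt
    · obtain ⟨l⟩ := nonempty_localLift p (hm hx)
      obtain ⟨m⟩ := nonempty_localLift q hx
      rw [descendVal_eq H α l l.mem, descendVal_eq H α m m.mem]
      exact LocalLift.val_eq H α hf he l m m.mem l.mem⟩

theorem pullbackInvariant_descend [SmoothConstSMul G X] (H : PlotsDenselyTranslate G X) {k : ℕ}
    (α : invariantForm G X k) : pullbackInvariant G X k (descend H α) = α := by
  refine Subtype.ext (Subtype.ext (funext fun p => funext fun x => ?_))
  change descendVal α (p.comp (orbitMk G X) (dSmooth_orbitMk G X)) x = α.1.1 p x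
  by_cases hx : x ∈ p.dom
  -- A plot of `X` is itself a lift of its projection.
  · exact descendVal_eq H α (p := p.comp (orbitMk G X) (dSmooth_orbitMk G X)) (z := x)
      ⟨p.dom, hx, le_rfl, p.map, p.isPlotOn, fun _ _ => rfl⟩ hx
  · exact (dif_neg hx).trans (α.1.2.2.1 p x hx).symm

theorem pullbackInvariant_injective [SmoothConstSMul G X] (k : ℕ) :
    Function.Injective (pullbackInvariant G X k) := by
  intro a b hab
  refine Subtype.ext (funext fun p => funext fun x => ?_)
  by_cases hx : x ∈ p.dom
  · obtain ⟨l⟩ := nonempty_localLift p hx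
    have h1 : a.1 (l.plot.comp (orbitMk G X) (dSmooth_orbitMk G X)) x =
        b.1 (l.plot.comp (orbitMk G X) (dSmooth_orbitMk G X)) x :=
      congrFun (congrFun (congrArg (fun c => c.1.1) hab) l.plot) x
    have h2 (c : Form (MulAction.orbitRel.Quotient G X) k) :=
      c.val_eq_of_eqOn (U := l.dom) (V := p.dom) (W := l.dom)
        (l.plot.comp (orbitMk G X) (dSmooth_orbitMk G X)).isPlotOn p.isPlotOn le_rfl l.le
        l.eqOn l.mem
    exact (h2 a).trans (h1.trans (h2 b).symm)
  · exact (a.2.2.1 p x hx).trans (b.2.2.1 p x hx).symm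

theorem isIso_pullbackComplex [SmoothConstSMul G X] (H : PlotsDenselyTranslate G X) :
    IsIso (pullbackComplex G X) := by
  have (k : ℕ) : IsIso ((pullbackComplex G X).f k) := by
    rw [ConcreteCategory.isIso_iff_bijective]
    exact ⟨pullbackInvariant_injective k, fun α => ⟨descend H α, pullbackInvariant_descend H α⟩⟩
  exact HomologicalComplex.Hom.isIso_of_components _

end Descent

/-! ### Dense translation under each of the two conditions -/

section Criteria

open MulOpposite

/-- The hypothesis `hK` expresses that `K` is diffeologically discrete. The `K`-component of a lift
of `(p, q)` through the canonical map is then the required constant, near every point of `U`. -/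
theorem plotsDenselyTranslate_of_isSubduction {X K : Type*} [DiffeologicalSpace X]
    [DiffeologicalSpace K] [Group K] [MulAction Kᵐᵒᵖ X]
    (hK : ∀ (n : ℕ) (U : Set (Euc n)), IsOpen U → ∀ κ : Euc n → K, IsPlotOn U κ → ∀ x ∈ U,
      ∃ V : Set (Euc n), IsOpen V ∧ x ∈ V ∧ V ⊆ U ∧ ∀ y ∈ V, κ y = κ x)
    (h : IsSubduction (canonicalMap X K)) : PlotsDenselyTranslate Kᵐᵒᵖ X := by
  classical
  intro n U hU p q hp hq hpq x hx
  refine subset_closure ⟨hx, ?_⟩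
  -- Off `U` the points `p y` and `q y` need not share an orbit, so the diagonal supplies a default
  -- value.
  let r : Euc n → {z : X × X // orbitMk Kᵐᵒᵖ X z.1 = orbitMk Kᵐᵒᵖ X z.2} := fun y =>
    if hy : y ∈ U then ⟨(p y, q y), hpq hy⟩ else ⟨(p y, p y), rfl⟩
  have hrU {y : Euc n} (hy : y ∈ U) : (r y).1 = (p y, q y) := by simp [r, hy]
  have hr : IsPlotOn U r := by
    intro m f hf hfU
    have h1 : (fun y => ((r ∘ f) y).1.1) = p ∘ f := funext fun y => by
      simp [hrU (hfU y)]
    have h2 : (fun y => ((r ∘ f) y).1.2) = q ∘ f := funext fun y => by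
      simp [hrU (hfU y)]
    exact ⟨show IsPlot (fun y => ((r ∘ f) y).1.1) from h1 ▸ hp m f hf hfU,
      show IsPlot (fun y => ((r ∘ f) y).1.2) from h2 ▸ hq m f hf hfU⟩
  rw [h.eq_pushforward, isPlotOn_pushforward_iff _ _ hU] at hr
  obtain ⟨V, hV, hxV, hVU, s, hs, hrs⟩ := hr x hx
  obtain ⟨W, hW, hxW, hWV, hconst⟩ := hK n V hV (fun y => (s y).2)
    (fun m f hf hfV => (hs m f hf hfV).2) x hxV
  refine ⟨op (s x).2, W, hW, hxW, hWV.trans hVU, fun y hy => ?_⟩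
  have h1 : (p y, q y) = ((s y).1, op (s y).2 • (s y).1) := by
    rw [← hrU (hVU (hWV hy)), hrs (hWV hy)]
    rfl
  obtain ⟨h2, h3⟩ := Prod.mk.inj h1
  rw [h3, h2, hconst y hy]

variable {G : Type*} [TopologicalSpace G] [Group G] [IsTopologicalGroup G]
  {N : Subgroup G}

/-- A plot of `G ⧸ N` lifts locally to a continuous map into `G`; as `N` is open, the quotient
topology is discrete, so the projection of that map is locally constant. -/
theorem exists_coset_plot_eq [DiffeologicalSpace G] (hN : IsOpen (N : Set G))
    (hG : ∀ (n : ℕ) (U : Set (Euc n)), IsOpen U → ∀ p : Euc n → G, IsPlotOn U p →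
      ContinuousOn p U) {n : ℕ} {U : Set (Euc n)} (hU : IsOpen U) {κ : Euc n → G ⧸ N}
    (hκ : IsPlotOn U κ) {x : Euc n} (hx : x ∈ U) :
    ∃ V : Set (Euc n), IsOpen V ∧ x ∈ V ∧ V ⊆ U ∧ ∀ y ∈ V, κ y = κ x := by
  have := QuotientGroup.discreteTopology hN
  obtain ⟨V, hV, hxV, hVU, g, hg, he⟩ := (isPlotOn_pushforward_iff
    (Quotient.mk (QuotientGroup.leftRel N)) Quotient.mk_surjective hU κ).1 hκ x hx
  have hc : ContinuousOn (fun y => (g y : G ⧸ N)) V :=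
    QuotientGroup.continuous_mk.comp_continuousOn (hG n V hV g hg)
  refine ⟨V ∩ (fun y => (g y : G ⧸ N)) ⁻¹' {(g x : G ⧸ N)},
    hc.isOpen_inter_preimage hV (isOpen_discrete _), ⟨hxV, rfl⟩,
    Set.inter_subset_left.trans hVU, fun y hy => ?_⟩
  exact ((he hy.1).trans hy.2).trans (he hxV).symm

/-- A Baire category argument: the element of `G` carrying one lift to the other may be chosen with
no continuity in the parameter, but countably many closed conditions exhaust the possibilities. -/
theorem plotsDenselyTranslate_of_secondCountable [N.Normal] {M : Type*} [TopologicalSpace M] [T2Space M]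
    [MulAction Gᵐᵒᵖ M] [DiffeologicalSpace M] [SecondCountableTopology G] [LocallyCompactSpace G]
    (hN : IsOpen (N : Set G))
    (hact : Continuous fun a : M × G => op a.2 • a.1)
    (hM : ∀ (n : ℕ) (U : Set (Euc n)), IsOpen U → ∀ p : Euc n → M, IsPlotOn U p →
      ContinuousOn p U) :
    PlotsDenselyTranslate (G ⧸ N)ᵐᵒᵖ (OrbitSpace N M) := by
  have := QuotientGroup.discreteTopology hN
  have : Countable (G ⧸ N) := TopologicalSpace.separableSpace_iff_countable.1 inferInstance
  intro n U hU p q hp hq hpq x hx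
  obtain ⟨V₁, hV₁, hxV₁, hVU₁, P, hP, hpP⟩ := (isPlotOn_pushforward_iff (orbitMk N.op M)
    Quotient.mk_surjective hU p).1 hp x hx
  obtain ⟨V₂, hV₂, hxV₂, hVU₂, Q, hQ, hqQ⟩ := (isPlotOn_pushforward_iff (orbitMk N.op M)
    Quotient.mk_surjective hU q).1 hq x hx
  let V : Set (Euc n) := V₁ ∩ V₂
  have hV : IsOpen V := hV₁.inter hV₂
  have hPc : Continuous fun u : V => P u :=
    ((hM n V₁ hV₁ P hP).mono Set.inter_subset_left).domRestrict
  have hQc : Continuous fun u : V => Q u :=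
    ((hM n V₂ hV₂ Q hQ).mono Set.inter_subset_right).domRestrict
  -- Fixing the coset makes the translation on `M/N` constant; intersecting with a compact piece of
  -- the σ-compact group `G` keeps the sets `C i` closed.
  let L (i : (G ⧸ N) × ℕ) : Set G :=
    compactCovering G i.2 ∩ (QuotientGroup.mk : G → G ⧸ N) ⁻¹' {i.1}
  have hL (i) : CompactSpace (L i) := isCompact_iff_compactSpace.1
    ((isCompact_compactCovering G i.2).inter_right
      ((isClosed_discrete {i.1}).preimage QuotientGroup.continuous_mk))
  let C (i : (G ⧸ N) × ℕ) : Set V := {u | ∃ h ∈ L i, Q u = op h • P u}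
  have hC (i) : IsClosed (C i) := by
    -- The incidence set is closed because `M` is Hausdorff, and projection along the compact factor
    -- `L i` is a closed map.
    have h1 : IsClosed {a : V × L i | Q a.1 = op (a.2 : G) • P a.1} :=
      isClosed_eq (hQc.comp continuous_fst)
        (hact.comp ((hPc.comp continuous_fst).prodMk (continuous_subtype_val.comp continuous_snd)))
    have h2 := isClosedMap_fst_of_compactSpace _ h1
    convert h2
    ext u
    constructor
    · rintro ⟨h, hh, he⟩
      exact ⟨(u, ⟨h, hh⟩), he, rfl⟩
    · rintro ⟨⟨u, h⟩, he, rfl⟩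
      exact ⟨h, h.2, he⟩
  have hcover : ⋃ i, C i = Set.univ := by
    refine Set.eq_univ_of_forall fun u => ?_
    have h1 : orbitMk (G ⧸ N)ᵐᵒᵖ (OrbitSpace N M) (q u) =
        orbitMk (G ⧸ N)ᵐᵒᵖ (OrbitSpace N M) (p u) := (hpq (hVU₁ u.2.1)).symm
    rw [hpP u.2.1, hqQ u.2.2] at h1
    -- Equality in the iterated quotient is unwound twice: a coset representative `g` matches the
    -- `N`-orbits, then an element of `N` matches the points, so `h` is their product.
    obtain ⟨k, hk⟩ := MulAction.orbitRel_apply.1 (Quotient.exact h1)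
    obtain ⟨k, rfl⟩ := op_surjective k
    obtain ⟨g, rfl⟩ := QuotientGroup.mk_surjective k
    change orbitMk N.op M (op g • P u) = orbitMk N.op M (Q u) at hk
    obtain ⟨m, hm⟩ := MulAction.orbitRel_apply.1 (Quotient.exact hk.symm)
    let h : G := g * (m : Gᵐᵒᵖ).unop
    obtain ⟨j, hj⟩ := exists_mem_compactCovering h
    refine Set.mem_iUnion.2 ⟨(QuotientGroup.mk h, j), h, ⟨hj, rfl⟩, ?_⟩
    rw [← hm]
    change (m : Gᵐᵒᵖ) • op g • P u = _
    rw [smul_smul]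
    rfl
  have : LocallyCompactSpace V := hV.locallyCompactSpace
  -- `V` is open in a Euclidean space, hence a Baire space.
  have hdense := Subtype.dense_iff.1 (dense_iUnion_interior_of_closed hC hcover)
  refine closure_mono ?_ (hdense ⟨hxV₁, hxV₂⟩)
  rintro _ ⟨u, hu, rfl⟩
  obtain ⟨i, hi⟩ := Set.mem_iUnion.1 hu
  refine ⟨hVU₁ u.2.1, op i.1, Subtype.val '' interior (C i),
    hV.isOpenMap_subtype_val _ isOpen_interior, ⟨u, hi, rfl⟩, ?_, ?_⟩
  · rintro _ ⟨v, -, rfl⟩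
    exact hVU₁ v.2.1
  · rintro _ ⟨v, hv, rfl⟩
    -- The element `h` depends on `v`, but its coset is always `i.1`.
    obtain ⟨h, hh, he⟩ := interior_subset hv
    have h2 : (QuotientGroup.mk h : G ⧸ N) = i.1 := hh.2
    rw [hqQ v.2.2, hpP v.2.1, ← h2]
    exact congrArg (orbitMk N.op M) he

theorem continuousOn_of_isPlotOn_manifold {E M : Type*} [NormedAddCommGroup E] [NormedSpace ℝ E]
    [TopologicalSpace M] [ChartedSpace E M] {n : ℕ} {U : Set (Euc n)} (hU : IsOpen U)
    {p : Euc n → M} (hp : @IsPlotOn M (manifoldDiffeology 𝓘(ℝ, E) M) n U p) :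
    ContinuousOn p U :=
  ContMDiffOn.continuousOn (I := 𝓘(ℝ, Euc n)) (I' := 𝓘(ℝ, E)) (n := ∞)
    ((isPlotOn_ofCorePlotsOn _ hU p).1 hp)

theorem isOpen_idComponent (F H : Type*) [NormedAddCommGroup F] [NormedSpace ℝ F]
    [TopologicalSpace H] [Group H] [IsTopologicalGroup H] [ChartedSpace F H] :
    IsOpen (idComponent H : Set H) := by
  have := ChartedSpace.locallyConnectedSpace F H
  exact isOpen_connectedComponent

end Criteria

end DeRham

theorem lemma3
    {E F M H : Type*}
    [NormedAddCommGroup E] [NormedSpace ℝ E] [FiniteDimensional ℝ E]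
    [NormedAddCommGroup F] [NormedSpace ℝ F] [FiniteDimensional ℝ F]
    [TopologicalSpace M] [T2Space M] [SecondCountableTopology M]
    [ChartedSpace E M] [IsManifold 𝓘(ℝ, E) ∞ M]
    [TopologicalSpace H] [Group H] [IsTopologicalGroup H]
    [ChartedSpace F H] [LieGroup 𝓘(ℝ, F) ∞ H]
    [MulAction Hᵐᵒᵖ M]
    (hsmooth : ContMDiff (𝓘(ℝ, E).prod 𝓘(ℝ, F)) 𝓘(ℝ, E) ∞
      (fun a : M × H => MulOpposite.op a.2 • a.1))
    (hfree : ∀ x : M, DiscreteTopology {h : H // MulOpposite.op h • x = x}) :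
    letI : DiffeologicalSpace M := DeRham.manifoldDiffeology 𝓘(ℝ, E) M
    letI : DiffeologicalSpace H := DeRham.manifoldDiffeology 𝓘(ℝ, F) H
    haveI : DeRham.SmoothConstSMul Hᵐᵒᵖ M := DeRham.smoothConstSMul_of_contMDiff hsmooth
    let X := DeRham.OrbitSpace (DeRham.idComponent H) M
    let K := H ⧸ DeRham.idComponent H
    (SecondCountableTopology H ∨ DeRham.IsSubduction (DeRham.canonicalMap X K)) →
      IsIso (DeRham.pullbackComplex Kᵐᵒᵖ X) := by
  intro X K h
  let _ : DiffeologicalSpace M := DeRham.manifoldDiffeology 𝓘(ℝ, E) M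
  let _ : DiffeologicalSpace H := DeRham.manifoldDiffeology 𝓘(ℝ, F) H
  have : DeRham.SmoothConstSMul Hᵐᵒᵖ M := DeRham.smoothConstSMul_of_contMDiff hsmooth
  have hopen := DeRham.isOpen_idComponent F H
  refine DeRham.isIso_pullbackComplex ?_
  rcases h with h | h
  -- Local compactness together with second countability yields the exhaustion of `H` by compact
  -- sets.
  · have := ChartedSpace.locallyCompactSpace F H
    exact DeRham.plotsDenselyTranslate_of_secondCountable hopen hsmooth.continuous
      fun _ _ hU _ hp => DeRham.continuousOn_of_isPlotOn_manifold hU hp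
  · exact DeRham.plotsDenselyTranslate_of_isSubduction
      (fun _ _ hU _ hκ _ hx => DeRham.exists_coset_plot_eq hopen
        (fun _ _ hU _ hp => DeRham.continuousOn_of_isPlotOn_manifold hU hp) hU hκ hx) h
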